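/- **Setting.** Let $\alpha\in(0,1)$, $\varsigma=\alpha/2$, $m,\varepsilon>0$, $\kappa\ge 0$. Let $F,f$ be functions on an open set $\mathrm{Dom}(f)\subseteq\mathbb R$ with $f=-F'$ continuously differentiable there, and let $\beta>0$ satisfy $[-\beta,\beta]\subseteq \mathrm{Dom}(f)$, $f(\pm\beta)=0$, $f>0$ on $\mathrm{Dom}(f)\cap(-\infty,-\beta)$ and $f<0$ on $\mathrm{Dom}(f)\cap(\beta,\infty)$. Let $V\in C^1(\mathbb R)\cap W^{2,\infty}(\mathbb R)$ satisfy $V(1)=1$, $V'(1)=0$, $|V'|\le K_1$ for some $K_1>0$, $0\le V\le K_2=1$, and $|V(z_1)-1|\le|V(z_2)-1|$ whenever $|z_1-1|\le|z_2-1|$. Let $L>0$, $M\ge1$, $h=L/M$, and let $\mathbb V_h$ be the space of real grid functions $v=(v_{i,j})$ that are $M$-periodic in $i$ and $j$, with $\|v\|_\infty=\max_{i,j}|v_{ij}|$, $\langle v,w\rangle=h^2\sum_{i,j=1}^M v_{ij}w_{ij}$ and the five-point Laplacian $\Delta_hv_{ij}=h^{-2}(v_{i+1,j}+v_{i-1,j}+v_{i,j+1}+v_{i,j-1}-4v_{ij})$.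 Put $g_h(v,w)=\exp(w)/\exp(\langle F(v),1\rangle)$. Let $0=t_0<t_1<\dots<t_N$ with $N\ge1$, $\tau_k=t_k-t_{k-1}$, $r_k=\tau_k/\tau_{k-1}$, $t_{k-1/2}=\tfrac12(t_{k-1}+t_k)$. For a sequence $w^k$ write $\nabla_\tau w^k=w^k-w^{k-1}$, $\mathbb D_\tau w^k=\nabla_\tau w^k/\tau_k$, $w^{n-\varsigma}=(1-\varsigma)w^n+\varsigma w^{n-1}$, and similarly $t_{n-\varsigma}=(1-\varsigma)t_n+\varsigma t_{n-1}$. With $\omega_{1-\alpha}(x)=x^{-\alpha}/\Gamma(1-\alpha)$ let $$a^{(n)}_{n-k}=\frac1{\tau_k}\int_{t_{k-1}}^{\min\{t_k,t_{n-\varsigma}\}}\omega_{1-\alpha}(t_{n-\varsigma}-s)\,ds\ (1\le k\le n),\qquad b^{(n)}_{n-k}=\frac{2}{\tau_k(\tau_k+\tau_{k+1})}\int_{t_{k-1}}^{t_k}(s-t_{k-\frac12})\,\omega_{1-\alpha}(t_{n-\varsigma}-s)\,ds\ (1\le k\le n-1),$$ and let $B^{(n)}_{n-k}=a^{(n)}_{n-k}+b^{(n)}_{n-k+1}/r_k-b^{(n)}_{n-k}$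 for $1\le k\le n$, where the $b^{(n)}_{n-k+1}/r_k$ term is omitted if $k=1$ and the $b^{(n)}_{n-k}$ term is omitted if $k=n$. Put $\tilde{\mathbb D}^\alpha_\tau w^n=\sum_{k=1}^nB^{(n)}_{n-k}\nabla_\tau w^k$. **Scheme.** Given $\phi^0\in\mathbb V_h$ and $R^0\in\mathbb R$, the unbalanced stabilized $L2$-$1_\sigma$-sESAV scheme computes predictions $\hat\phi^n$ with $\hat\phi^0=\phi^0$: $\hat\phi^1$ is a solution, with $\hat\phi^{1-\varsigma}$ taking values in $\mathrm{Dom}(f)$, of $$B_0^{(1)}(\hat\phi^1-\phi^0)=m\big(\varepsilon^2\Delta_h\hat\phi^{1-\varsigma}+f(\hat\phi^{1-\varsigma})\big),$$ and $\hat\phi^n=\min\{\max\{(1+r_n)\phi^{n-1}-r_n\phi^{n-2},-\beta\},\beta\}$ for $2\le n\le N$, where $\hat\phi^{n-\varsigma}:=(1-\varsigma)\hat\phi^n+\varsigma\phi^{n-1}$. With $V^{n-\varsigma}:=V(g_h(\hat\phi^{n-\varsigma},R^{n-1}))$, the pair $(\phi^n,R^n)\in\mathbb V_h\times\mathbb R$,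 $1\le n\le N$, satisfies $$\tilde{\mathbb D}^\alpha_\tau\phi^n=m\big(\varepsilon^2\Delta_h\phi^{n-\varsigma}+V^{n-\varsigma}f(\hat\phi^{n-\varsigma})-\kappa(\phi^{n-\varsigma}-V^{n-\varsigma}\hat\phi^{n-\varsigma})\big),$$ $$\mathbb D_\tau R^n=-V^{n-\varsigma}\langle f(\hat\phi^{n-\varsigma}),\mathbb D_\tau\phi^n\rangle+\kappa\langle\phi^{n-\varsigma}-V^{n-\varsigma}\hat\phi^{n-\varsigma},\mathbb D_\tau\phi^n\rangle.$$ **Theorem.** Assume $r_k\ge4/7$ for $2\le k\le N$, $\kappa\ge\max_{[-\beta,\beta]}|f'|$, $$\tau_1\le\Big(\frac{4}{11\,\varsigma m(\kappa+4\varepsilon^2/h^2)\Gamma(2-\alpha)}\Big)^{1/\alpha},\qquad \tau_1\le\Big(\frac{4}{11\,\kappa(1-\varsigma)m\Gamma(2-\alpha)}\Big)^{1/\alpha}$$ (the second condition being void if $\kappa=0$), and $$\tau_n\le\Big(\frac{4}{11(1-\varsigma)m(4\varepsilon^2/h^2+\kappa)\Gamma(2-\alpha)}\Big)^{1/\alpha},\qquad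 1\le n\le N.$$ Then the scheme preserves the discrete maximum-bound principle: if $\|\phi^0\|_\infty\le\beta$, then $\|\phi^n\|_\infty\le\beta$ for all $1\le n\le N$. Moreover, for all $1\le n\le N$, with the penalty term $\mathcal P^n:=\kappa m(V^{n-\varsigma}-1)\beta$, one has $\mathcal P^n\le0$ and $$\big(B_0^{(n)}+\kappa(1-\varsigma)m\big)\|\phi^n\|_\infty\le B_0^{(n)}\beta+\kappa(1-\varsigma)m\beta+\mathcal P^n .$$ -/

import Mathlib

open MeasureTheory
open scoped ContDiff ENNReal

noncomputable section

namespace TFAC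

/-! ### The nonlinearity and the auxiliary functional -/

/-- The standing assumptions on the potential: `D` is the (open) domain of `f = -F'`, `f` is
continuously differentiable on it, `β > 0` with `[-β, β] ⊆ D`, `f (±β) = 0`, `f > 0` to the left
of `-β` and `f < 0` to the right of `β`. Values of `f`, `F` outside `D` carry no meaning. -/
structure IsPotential (D : Set ℝ) (F f : ℝ → ℝ) (β : ℝ) : Prop where
  isOpen_dom : IsOpen D
  beta_pos : 0 < β
  Icc_subset : Set.Icc (-β) β ⊆ D
  contDiffOn : ContDiffOn ℝ 1 f D
  hasDerivAt : ∀ x ∈ D, HasDerivAt F (-f x) x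
  map_beta : f β = 0
  map_neg_beta : f (-β) = 0
  pos_left : ∀ x ∈ D, x < -β → 0 < f x
  neg_right : ∀ x ∈ D, β < x → f x < 0

/-- `w` is the weak derivative of `u` on the real line. -/
def HasWeakDeriv (u w : ℝ → ℝ) : Prop :=
  LocallyIntegrable u ∧ LocallyIntegrable w ∧
    ∀ ψ : ℝ → ℝ, ContDiff ℝ ∞ ψ → HasCompactSupport ψ →
      ∫ x, u x * deriv ψ x = -∫ x, w x * ψ x

/-- Membership in the Sobolev space `W^{2,∞}(ℝ)`. -/
def MemW2Infty (u : ℝ → ℝ) : Prop :=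
  ∃ u₁ u₂ : ℝ → ℝ, HasWeakDeriv u u₁ ∧ HasWeakDeriv u₁ u₂ ∧
    MemLp u ∞ ∧ MemLp u₁ ∞ ∧ MemLp u₂ ∞

/-- The assumptions on the auxiliary functional `V`, with upper bound `K₂`. -/
structure IsAuxiliary (V : ℝ → ℝ) (K₂ : ℝ) : Prop where
  contDiff : ContDiff ℝ 1 V
  memW2Infty : MemW2Infty V
  map_one : V 1 = 1
  deriv_one : deriv V 1 = 0
  deriv_bounded : ∃ K₁ : ℝ, 0 < K₁ ∧ ∀ z, |deriv V z| ≤ K₁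
  nonneg : ∀ z, 0 ≤ V z
  le_bound : ∀ z, V z ≤ K₂
  monotone : ∀ z₁ z₂ : ℝ, |z₁ - 1| ≤ |z₂ - 1| → |V z₁ - 1| ≤ |V z₂ - 1|

/-! ### Grid functions -/

/-- Real grid functions that are `M`-periodic in both directions. For `M ≠ 0` the norm `‖v‖` on
this space is the discrete maximum norm `max_{i,j} |v (i, j)|`. -/
abbrev Grid (M : ℕ) : Type := ZMod M × ZMod M → ℝ

/-- The five-point discrete Laplacian with mesh width `h`. -/
def lap {M : ℕ} (h : ℝ) (v : Grid M) : Grid M := fun p =>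
  (v (p.1 + 1, p.2) + v (p.1 - 1, p.2) + v (p.1, p.2 + 1) + v (p.1, p.2 - 1) - 4 * v p) / h ^ 2

/-- The discrete inner product `h² ∑ v w`. -/
def ip {M : ℕ} [NeZero M] (h : ℝ) (v w : Grid M) : ℝ := h ^ 2 * ∑ p, v p * w p

/-- `E_{1h}[v] = ⟨F(v), 1⟩`. -/
def energyOne {M : ℕ} [NeZero M] (F : ℝ → ℝ) (h : ℝ) (v : Grid M) : ℝ :=
  ip h (fun p => F (v p)) (fun _ => 1)

/-- `g_h(v, w) = exp(w) / exp(E_{1h}[v])`. -/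
def gh {M : ℕ} [NeZero M] (F : ℝ → ℝ) (h : ℝ) (v : Grid M) (w : ℝ) : ℝ :=
  Real.exp w / Real.exp (energyOne F h v)

/-! ### Time levels and the kernels of the nonuniform L2-1σ formula -/

/-- The time step `τ_k = t_k - t_{k-1}` (used for `k ≥ 1`). -/
def step (t : ℕ → ℝ) (k : ℕ) : ℝ := t k - t (k - 1)

/-- The ratio `r_k = τ_k / τ_{k-1}` (used for `k ≥ 2`). -/
def ratio (t : ℕ → ℝ) (k : ℕ) : ℝ := step t k / step t (k - 1)

/-- The weighted value `u^{n-s} = (1 - s) u^n + s u^{n-1}` for a weight `s`; for `u = t` this is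
the off-set time level `t_{n-s}`. -/
def offset {E : Type*} [AddCommGroup E] [Module ℝ E] (s : ℝ) (u : ℕ → E) (n : ℕ) : E :=
  (1 - s) • u n + s • u (n - 1)

/-- `ω_μ(x) = x^{μ-1} / Γ(μ)`. -/
def omega (μ x : ℝ) : ℝ := x ^ (μ - 1) / Real.Gamma μ

/-- `coefA α t n k` is the coefficient `a^{(n)}_{n-k}`, `1 ≤ k ≤ n`. -/
def coefA (α : ℝ) (t : ℕ → ℝ) (n k : ℕ) : ℝ :=
  (1 / step t k) *
    ∫ s in (t (k - 1))..(min (t k) (offset (α / 2) t n)),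
      omega (1 - α) (offset (α / 2) t n - s)

/-- `coefB α t n k` is the coefficient `b^{(n)}_{n-k}`, `1 ≤ k ≤ n - 1`. -/
def coefB (α : ℝ) (t : ℕ → ℝ) (n k : ℕ) : ℝ :=
  (2 / (step t k * (step t k + step t (k + 1)))) *
    ∫ s in (t (k - 1))..(t k),
      (s - (t (k - 1) + t k) / 2) * omega (1 - α) (offset (α / 2) t n - s)

/-- `kernel α t n k` is the discrete convolution kernel `B^{(n)}_{n-k}`, `1 ≤ k ≤ n`:
`a_{n-k} + b_{n-k+1} / r_k - b_{n-k}`, where the second term is absent for `k = 1` and the third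
one is absent for `k = n`. -/
def kernel (α : ℝ) (t : ℕ → ℝ) (n k : ℕ) : ℝ :=
  coefA α t n k + (if 2 ≤ k then coefB α t n (k - 1) / ratio t k else 0)
    - (if k < n then coefB α t n k else 0)

/-- The discrete Caputo derivative `∑_{k=1}^n B^{(n)}_{n-k} (u^k - u^{k-1})`. -/
def caputo {E : Type*} [AddCommGroup E] [Module ℝ E] (α : ℝ) (t : ℕ → ℝ) (u : ℕ → E) (n : ℕ) :
    E :=
  ∑ k ∈ Finset.Icc 1 n, kernel α t n k • (u k - u (k - 1))

/-- The time-step bound `(4 / (11 c Γ(2-α)))^{1/α}`. -/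
def stepBound (α c : ℝ) : ℝ := (4 / (11 * c * Real.Gamma (2 - α))) ^ (1 / α)

/-! ### The scheme -/

/-- The weighted prediction `φ̂^{n-ς} = (1 - ς) φ̂^n + ς φ^{n-1}`, `ς = α / 2`. -/
def predOffset {M : ℕ} (α : ℝ) (φ φhat : ℕ → Grid M) (n : ℕ) : Grid M :=
  (1 - α / 2) • φhat n + (α / 2) • φ (n - 1)

/-- `V^{n-ς} = V(g_h(φ̂^{n-ς}, R^{n-1}))`. -/
def auxValue {M : ℕ} [NeZero M] (V F : ℝ → ℝ) (α h : ℝ) (φ φhat : ℕ → Grid M) (R : ℕ → ℝ)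
    (n : ℕ) : ℝ :=
  V (gh F h (predOffset α φ φhat n) (R (n - 1)))

/-- `φ`, `φ̂`, `R` are produced by the unbalanced stabilized L2-1σ-sESAV scheme on the time levels
`t 0 < ⋯ < t N`. -/
structure IsUnbalancedScheme {M : ℕ} [NeZero M] (D : Set ℝ) (F f V : ℝ → ℝ)
    (α m ε κ β h : ℝ) (N : ℕ) (t : ℕ → ℝ) (φ φhat : ℕ → Grid M) (R : ℕ → ℝ) : Prop where
  hat_zero : φhat 0 = φ 0
  /-- The argument of the nonlinearity in the implicit prediction step lies in its domain. -/
  predict_one_mem : ∀ p, predOffset α φ φhat 1 p ∈ D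
  /-- The fully implicit prediction `φ̂^1`. -/
  predict_one : kernel α t 1 1 • (φhat 1 - φ 0) =
    m • (ε ^ 2 • lap h (predOffset α φ φhat 1) + fun p => f (predOffset α φ φhat 1 p))
  /-- The predictions `φ̂^n`, `n ≥ 2`, by truncated linear extrapolation. -/
  predict : ∀ n, 2 ≤ n → n ≤ N → ∀ p,
    φhat n p = min (max ((1 + ratio t n) * φ (n - 1) p - ratio t n * φ (n - 2) p) (-β)) β
  phase : ∀ n, 1 ≤ n → n ≤ N →
    caputo α t φ n =
      m • (ε ^ 2 • lap h (offset (α / 2) φ n)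
        + auxValue V F α h φ φhat R n • (fun p => f (predOffset α φ φhat n p))
        - κ • (offset (α / 2) φ n - auxValue V F α h φ φhat R n • predOffset α φ φhat n))
  scalar : ∀ n, 1 ≤ n → n ≤ N →
    (R n - R (n - 1)) / step t n =
      -auxValue V F α h φ φhat R n *
          ip h (fun p => f (predOffset α φ φhat n p)) ((1 / step t n) • (φ n - φ (n - 1)))
        + κ * ip h (offset (α / 2) φ n - auxValue V F α h φ φhat R n • predOffset α φ φhat n)
            ((1 / step t n) • (φ n - φ (n - 1)))

end TFAC

end

/-! The proof is a discrete maximum principle, by strong induction on the time level. Write ς = α/2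
and c = m(4ε²/h² + κ).

Kernels: the weight w(s) = ω_{1-α}(t_{n-ς} - s) is increasing and convex, and for k < n the kernel
B_{n-k} lies between the nodal values w(t_{k-1}) and w(t_k) (`le_kernel_of_lt`, `kernel_le_of_lt`),
hence increases with k. The upper bound uses r_k ≥ 4/7. At the last interval (1-ς)B₁ ≤ (1-α)B₀
(`kernel_pred_le`), so d = B₀ - B₁ ≥ ςB₀/(1-ς) ≥ ςc, since the step restriction gives B₀ ≥ (1-ς)c.
For n = 1, d = B₀ and the first-step restriction gives d ≥ ςc directly. By `exists_caputo_split` the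
history beyond φ^{n-1} contributes at most (B₀ - d)β.

Step: at an extremum of φⁿ its Laplacian has the right sign. The bound d ≥ ςc makes the explicit
terms in φ^{n-1} a nonnegative combination, and |f(x) + κx| ≤ κβ on [-β, β] (`abs_add_mul_le`)
controls the nonlinearity at the prediction, which `abs_le_of_implicit_step` or truncation keeps in
range. `norm_step_le` adds these bounds; 0 ≤ V ≤ 1 does the rest. -/

namespace TFAC

/-! ### First moments of monotone and convex functions -/

/-- The centred first moment of `w` over `[a, b]`. -/
noncomputable def moment (w : ℝ → ℝ) (a b : ℝ) : ℝ := ∫ s in a..b, (s - (a + b) / 2) * w s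

theorem integral_sub_const (a b c : ℝ) :
    ∫ s in a..b, (s - c) = (b - a) * ((a + b) / 2 - c) := by
  rw [intervalIntegral.integral_sub (by simp) (by simp)]
  simp only [integral_id, intervalIntegral.integral_const, smul_eq_mul]
  ring

theorem integral_centred_sq (a b : ℝ) :
    ∫ s in a..b, (s - (a + b) / 2) ^ 2 = (b - a) ^ 3 / 12 := by
  rw [intervalIntegral.integral_comp_sub_right (fun s => s ^ 2)]
  simp only [integral_pow]
  push_cast
  ring

section

variable {w : ℝ → ℝ} {a b : ℝ}

theorem intervalIntegrable_of_monotoneOn (hab : a ≤ b) (hw : MonotoneOn w (Set.Icc a b)) :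
    IntervalIntegrable w volume a b :=
  MonotoneOn.intervalIntegrable (by rwa [Set.uIcc_of_le hab])

theorem intervalIntegrable_centred_mul (hab : a ≤ b) (hw : MonotoneOn w (Set.Icc a b)) :
    IntervalIntegrable (fun s => (s - (a + b) / 2) * w s) volume a b :=
  (intervalIntegrable_of_monotoneOn hab hw).continuousOn_mul (by fun_prop)

/-- The centred factor has mean zero, so each moment estimate below may choose its own baseline for
`w`. -/
theorem moment_eq_sub_const (hab : a ≤ b) (hw : MonotoneOn w (Set.Icc a b)) (c : ℝ) :
    moment w a b = ∫ s in a..b, (s - (a + b) / 2) * (w s - c) := by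
  simp only [mul_sub, moment]
  rw [intervalIntegral.integral_sub (intervalIntegrable_centred_mul hab hw)
      (Continuous.intervalIntegrable (by fun_prop) _ _),
    intervalIntegral.integral_mul_const, integral_sub_const]
  ring

/-- With the midpoint value as baseline, both factors of the integrand have the same sign. -/
theorem moment_nonneg (hab : a ≤ b) (hw : MonotoneOn w (Set.Icc a b)) : 0 ≤ moment w a b := by
  rw [moment_eq_sub_const hab hw (w ((a + b) / 2))]
  refine intervalIntegral.integral_nonneg hab fun s hs => ?_
  have hmid : (a + b) / 2 ∈ Set.Icc a b := ⟨by linarith, by linarith⟩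
  rcases le_total s ((a + b) / 2) with h | h
  · exact mul_nonneg_of_nonpos_of_nonpos (by linarith) (by linarith [hw hs hmid h])
  · exact mul_nonneg (by linarith) (by linarith [hw hmid hs h])

theorem moment_le_integral (hab : a ≤ b) (hw : MonotoneOn w (Set.Icc a b)) :
    moment w a b ≤ (b - a) / 2 * ((∫ s in a..b, w s) - (b - a) * w a) := by
  have hi := intervalIntegrable_of_monotoneOn hab hw
  have e : (b - a) / 2 * ((∫ s in a..b, w s) - (b - a) * w a)
      = ∫ s in a..b, (b - a) / 2 * (w s - w a) := by
    rw [intervalIntegral.integral_const_mul, intervalIntegral.integral_sub hi (by simp)]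
    simp
  rw [e, moment_eq_sub_const hab hw (w a)]
  refine intervalIntegral.integral_mono_on hab
    ((hi.sub (by simp)).continuousOn_mul (by fun_prop))
    ((hi.sub (by simp)).const_mul _) fun s hs => ?_
  exact mul_le_mul_of_nonneg_right (by linarith [hs.2])
    (by linarith [hw (Set.left_mem_Icc.2 hab) hs hs.1])

/-- With the midpoint value as baseline, the integrand is at most `p` times the squared distance to
the midpoint. -/
theorem moment_le_of_slope_le (hab : a ≤ b) (hw : MonotoneOn w (Set.Icc a b)) {p : ℝ}
    (hp : ∀ x ∈ Set.Icc a b, ∀ y ∈ Set.Icc a b, x ≤ y → w y - w x ≤ p * (y - x)) :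
    moment w a b ≤ p * ((b - a) ^ 3 / 12) := by
  have hi := intervalIntegrable_of_monotoneOn hab hw
  rw [← integral_centred_sq, ← intervalIntegral.integral_const_mul,
    moment_eq_sub_const hab hw (w ((a + b) / 2))]
  refine intervalIntegral.integral_mono_on hab
    ((hi.sub (by simp)).continuousOn_mul (by fun_prop))
    (Continuous.intervalIntegrable (by fun_prop) _ _) fun s hs => ?_
  have hmid : (a + b) / 2 ∈ Set.Icc a b := ⟨by linarith, by linarith⟩
  rcases le_total s ((a + b) / 2) with h | h
  · nlinarith [mul_le_mul_of_nonneg_left (hp s hs _ hmid h) (sub_nonneg.2 h)]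
  · nlinarith [mul_le_mul_of_nonneg_left (hp _ hmid s hs h) (sub_nonneg.2 h)]

theorem integral_le_trapezoid (hab : a < b) (hw : MonotoneOn w (Set.Icc a b))
    (hc : ConvexOn ℝ (Set.Icc a b) w) :
    ∫ s in a..b, w s ≤ (b - a) * ((w a + w b) / 2) := by
  have hba : 0 < b - a := sub_pos.2 hab
  have e : (b - a) * ((w a + w b) / 2)
      = ∫ s in a..b, (w a + (w b - w a) / (b - a) * (s - a)) := by
    rw [intervalIntegral.integral_add (by simp) (Continuous.intervalIntegrable (by fun_prop) _ _),
      intervalIntegral.integral_const_mul, integral_sub_const]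
    simp only [intervalIntegral.integral_const, smul_eq_mul]
    field_simp
    ring
  rw [e]
  refine intervalIntegral.integral_mono_on hab.le (intervalIntegrable_of_monotoneOn hab.le hw)
    (Continuous.intervalIntegrable (by fun_prop) _ _) fun s hs => ?_
  have h := hc.2 (Set.left_mem_Icc.2 hab.le) (Set.right_mem_Icc.2 hab.le)
    (div_nonneg (sub_nonneg.2 hs.2) hba.le) (div_nonneg (sub_nonneg.2 hs.1) hba.le)
    (by field_simp; ring)
  simp only [smul_eq_mul] at h
  have e1 : (b - s) / (b - a) * a + (s - a) / (b - a) * b = s := by field_simp; ring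
  have e2 : (b - s) / (b - a) * w a + (s - a) / (b - a) * w b
      = w a + (w b - w a) / (b - a) * (s - a) := by field_simp; ring
  rwa [e1, e2] at h

/-- On `[a, b]` a convex function grows at most with the slope of its chord over `[b, c]`. -/
theorem sub_le_chord_slope {c : ℝ} (hbc : b < c) (hc : ConvexOn ℝ (Set.Icc a c) w)
    {x y : ℝ} (hx : x ∈ Set.Icc a b) (hy : y ∈ Set.Icc a b) (hxy : x ≤ y) :
    w y - w x ≤ (w c - w b) / (c - b) * (y - x) := by
  rcases hxy.eq_or_lt with rfl | hxy
  · simp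
  have hx' : x ∈ Set.Icc a c := ⟨hx.1, hx.2.trans hbc.le⟩
  have hy' : y ∈ Set.Icc a c := ⟨hy.1, hy.2.trans hbc.le⟩
  have hc' : c ∈ Set.Icc a c := ⟨hx'.1.trans hx'.2, le_rfl⟩
  rw [← div_le_iff₀ (sub_pos.2 hxy)]
  -- If `y = b` the two chords are adjacent; otherwise the chord over `[y, b]` links them.
  rcases hy.2.eq_or_lt with rfl | hyb
  · exact hc.slope_mono_adjacent hx' hc' hxy hbc
  · exact (hc.slope_mono_adjacent hx' ⟨hy.1.trans hyb.le, hbc.le⟩ hxy hyb).trans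
      (hc.slope_mono_adjacent hy' hc' hyb hbc)

/-- For adjacent intervals `[a, b]` and `[b, c]` whose length ratio `r` is at least `4 / 7`, the
average of a monotone convex function over `[b, c]`, corrected by its scaled moment over `[a, b]`,
does not exceed the value at `c`. -/
theorem average_add_moment_le {c : ℝ} (hab : a < b) (hbc : b < c)
    (hw : MonotoneOn w (Set.Icc a c)) (hc : ConvexOn ℝ (Set.Icc a c) w)
    (hr : 4 / 7 ≤ (c - b) / (b - a)) :
    1 / (c - b) * (∫ s in b..c, w s)
      + 2 / ((b - a) * ((b - a) + (c - b))) * moment w a b / ((c - b) / (b - a)) ≤ w c := by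
  have hba : 0 < b - a := sub_pos.2 hab
  have hcb : 0 < c - b := sub_pos.2 hbc
  have hab' : Set.Icc a b ⊆ Set.Icc a c := Set.Icc_subset_Icc_right hbc.le
  have hbc' : Set.Icc b c ⊆ Set.Icc a c := Set.Icc_subset_Icc_left hab.le
  have h1 := integral_le_trapezoid hbc (hw.mono hbc') (hc.subset hbc' (convex_Icc _ _))
  have h2 := moment_le_of_slope_le hab.le (hw.mono hab')
    fun x hx y hy hxy => sub_le_chord_slope hbc hc hx hy hxy
  have hd : 0 ≤ w c - w b :=
    sub_nonneg.2 (hw ⟨hab.le, hbc.le⟩ ⟨(hab.trans hbc).le, le_rfl⟩ hbc.le)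
  rw [le_div_iff₀ hba] at hr
  have h3 : 1 / (c - b) * (∫ s in b..c, w s) ≤ (w b + w c) / 2 := by
    rw [one_div, inv_mul_le_iff₀ hcb]
    exact h1
  have h4 : 2 / ((b - a) * ((b - a) + (c - b))) * moment w a b / ((c - b) / (b - a))
      ≤ (w c - w b) / 2 := by
    generalize moment w a b = J at *
    generalize w c - w b = d at *
    generalize b - a = x at *
    generalize c - b = y at *
    -- This is what bounds d·x³ / (6y²(x + y)) by d/2. The ratio 4/7 suffices because
    -- 3·(4/7)²·(11/7) > 1.
    have hxy : x ^ 3 ≤ 3 * y ^ 2 * (x + y) := by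
      have h5 : (4 / 7 * x) ^ 2 ≤ y ^ 2 := pow_le_pow_left₀ (by positivity) hr 2
      have h6 : (4 / 7 * x) ^ 2 * (x + 4 / 7 * x) ≤ y ^ 2 * (x + y) :=
        mul_le_mul h5 (by linarith) (by positivity) (by positivity)
      nlinarith [pow_pos hba 3]
    calc 2 / (x * (x + y)) * J / (y / x) = 2 / ((x + y) * y) * J := by field_simp
      _ ≤ 2 / ((x + y) * y) * (d / y * (x ^ 3 / 12)) := by gcongr
      _ = d * x ^ 3 / (6 * y ^ 2 * (x + y)) := by field_simp; ring
      _ ≤ d * (3 * y ^ 2 * (x + y)) / (6 * y ^ 2 * (x + y)) := by gcongr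
      _ = d / 2 := by field_simp; ring
  linarith

/-- The average of a monotone function over `[a, b]`, corrected by its scaled moment over the same
interval, is at least the value at `a`. -/
theorem le_average_sub_moment {τ : ℝ} (hab : a < b) (hτ : 0 < τ)
    (hw : MonotoneOn w (Set.Icc a b)) :
    w a ≤ 1 / (b - a) * (∫ s in a..b, w s)
      - 2 / ((b - a) * ((b - a) + τ)) * moment w a b := by
  have hba : 0 < b - a := sub_pos.2 hab
  have h1 := moment_le_integral hab.le hw
  have h0 := moment_nonneg hab.le hw
  -- The moment is nonnegative, so dropping `τ` only enlarges the term; the remaining bound then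
  -- cancels exactly against the average.
  have h2 : 2 / ((b - a) * ((b - a) + τ)) * moment w a b
      ≤ 2 / ((b - a) * (b - a)) * moment w a b := by
    gcongr
    linarith
  have h3 : 2 / ((b - a) * (b - a)) * moment w a b
      ≤ 2 / ((b - a) * (b - a)) * ((b - a) / 2 * ((∫ s in a..b, w s) - (b - a) * w a)) := by
    gcongr
  have h4 : 2 / ((b - a) * (b - a)) * ((b - a) / 2 * ((∫ s in a..b, w s) - (b - a) * w a))
      = 1 / (b - a) * (∫ s in a..b, w s) - w a := by field_simp
  linarith

end

/-! ### The weight of the Caputo derivative -/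

/-- The function is the exponential of the convex function -p log x. -/
theorem convexOn_rpow_neg {p : ℝ} (hp : 0 ≤ p) :
    ConvexOn ℝ (Set.Ioi 0) fun x : ℝ => x ^ (-p) := by
  have h := ((strictConcaveOn_log_Ioi.concaveOn.neg).smul hp)
  refine ⟨convex_Ioi 0, fun x hx y hy a b ha hb hab => ?_⟩
  have h1 := h.2 hx hy ha hb hab
  have hxy : a • x + b • y ∈ Set.Ioi (0 : ℝ) := convex_Ioi 0 hx hy ha hb hab
  have h2 := convexOn_exp.2 (Set.mem_univ (p • (-Real.log) x)) (Set.mem_univ (p • (-Real.log) y))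
    ha hb hab
  have h3 := (Real.exp_le_exp.2 h1).trans h2
  simp only [Real.rpow_def_of_pos (Set.mem_Ioi.1 hx), Real.rpow_def_of_pos (Set.mem_Ioi.1 hy),
    Real.rpow_def_of_pos (Set.mem_Ioi.1 hxy)]
  simpa [mul_comm] using h3

theorem monotoneOn_omega_sub {α : ℝ} (hα0 : 0 < α) (hα1 : α < 1) (T : ℝ) :
    MonotoneOn (fun s => omega (1 - α) (T - s)) (Set.Iio T) := by
  intro x hx y hy hxy
  simp only [omega, Set.mem_Iio] at *
  have : 0 < Real.Gamma (1 - α) := Real.Gamma_pos_of_pos (by linarith)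
  gcongr ?_ / _
  exact Real.rpow_le_rpow_of_nonpos (by linarith) (by linarith) (by linarith)

theorem convexOn_omega_sub {α : ℝ} (hα0 : 0 < α) (hα1 : α < 1) (T : ℝ) :
    ConvexOn ℝ (Set.Iio T) (fun s => omega (1 - α) (T - s)) := by
  have hG : 0 < Real.Gamma (1 - α) := Real.Gamma_pos_of_pos (by linarith)
  refine ⟨convex_Iio T, fun x hx y hy a b ha hb hab => ?_⟩
  have h := (convexOn_rpow_neg hα0.le).2 (x := T - x) (y := T - y) (by simpa using hx)
    (by simpa using hy) ha hb hab
  have e : T - (a • x + b • y) = a • (T - x) + b • (T - y) := by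
    simp only [smul_eq_mul]
    linear_combination -T * hab
  have e2 : 1 - α - 1 = -α := by ring
  simp only [omega]
  rw [e, e2]
  simp only [smul_eq_mul] at h ⊢
  calc _ ≤ (a * (T - x) ^ (-α) + b * (T - y) ^ (-α)) / Real.Gamma (1 - α) := by gcongr
    _ = _ := by ring

theorem integral_omega_sub {α : ℝ} (hα1 : α < 1) (T c : ℝ) :
    ∫ s in c..T, omega (1 - α) (T - s) = (T - c) ^ (1 - α) / Real.Gamma (2 - α) := by
  have hG : Real.Gamma (2 - α) = (1 - α) * Real.Gamma (1 - α) := by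
    rw [← Real.Gamma_add_one (by linarith)]
    ring_nf
  have h1 : (1 - α) ≠ 0 := by linarith
  simp only [omega, intervalIntegral.integral_div]
  rw [intervalIntegral.integral_comp_sub_left (fun s => s ^ (1 - α - 1)),
    integral_rpow (Or.inl (by linarith)), hG]
  simp only [sub_self, sub_add_cancel, Real.zero_rpow h1, sub_zero]
  rw [div_div]

/-! ### Bounds for the discrete convolution kernels -/

theorem offset_sub_prev (s : ℝ) (t : ℕ → ℝ) (n : ℕ) :
    offset s t n - t (n - 1) = (1 - s) * step t n := by
  simp only [offset, step, smul_eq_mul]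
  ring

theorem offset_eq_sub (s : ℝ) (t : ℕ → ℝ) (n : ℕ) :
    offset s t n = t n - s * step t n := by
  simp only [offset, step, smul_eq_mul]
  ring

theorem coefB_eq_moment (α : ℝ) (t : ℕ → ℝ) (n k : ℕ) :
    coefB α t n k = 2 / (step t k * (step t k + step t (k + 1))) *
      moment (fun s => omega (1 - α) (offset (α / 2) t n - s)) (t (k - 1)) (t k) := rfl

section

variable {α : ℝ} {t : ℕ → ℝ} {n k : ℕ}

theorem step_pos (ht : StrictMonoOn t (Set.Iic n)) (hk : 1 ≤ k) (hkn : k ≤ n) : 0 < step t k :=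
  sub_pos.2 (ht (Set.mem_Iic.2 (by omega)) hkn (by omega))

/-- For k < n the singularity of the weight lies strictly to the right of the k-th interval; only
the last interval, cut at the off-set time, reaches it. -/
theorem lt_offset (hα1 : α < 1) (ht : StrictMonoOn t (Set.Iic n)) (hk : k < n) :
    t k < offset (α / 2) t n := by
  have h1 : t k ≤ t (n - 1) :=
    ht.monotoneOn (Set.mem_Iic.2 hk.le) (Set.mem_Iic.2 (by omega)) (by omega)
  have h2 := offset_sub_prev (α / 2) t n
  have h3 : 0 < (1 - α / 2) * step t n :=
    mul_pos (by linarith) (step_pos ht (by omega) le_rfl)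
  linarith

theorem coefA_of_lt (hα1 : α < 1) (ht : StrictMonoOn t (Set.Iic n)) (hk : k < n) :
    coefA α t n k = 1 / step t k *
      ∫ s in (t (k - 1))..(t k), omega (1 - α) (offset (α / 2) t n - s) := by
  rw [coefA, min_eq_left (lt_offset hα1 ht hk).le]

theorem Icc_subset_Iio_offset (hα1 : α < 1) (ht : StrictMonoOn t (Set.Iic n)) (hk : k < n)
    (a : ℝ) : Set.Icc a (t k) ⊆ Set.Iio (offset (α / 2) t n) :=
  fun _ hx => hx.2.trans_lt (lt_offset hα1 ht hk)

theorem coefB_nonneg (hα0 : 0 < α) (hα1 : α < 1) (ht : StrictMonoOn t (Set.Iic n))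
    (hk : 1 ≤ k) (hkn : k < n) : 0 ≤ coefB α t n k := by
  have h1 := step_pos ht hk hkn.le
  have h2 := step_pos ht (k := k + 1) (by omega) (by omega)
  have h3 := moment_nonneg (sub_pos.1 h1).le ((monotoneOn_omega_sub hα0 hα1 _).mono
    (Icc_subset_Iio_offset hα1 ht hkn (t (k - 1))))
  rw [coefB_eq_moment]
  positivity

theorem ratio_pos (ht : StrictMonoOn t (Set.Iic n)) (hk : 2 ≤ k) (hkn : k ≤ n) :
    0 < ratio t k :=
  div_pos (step_pos ht (by omega) hkn) (step_pos ht (by omega) (by omega))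

theorem le_kernel_of_lt (hα0 : 0 < α) (hα1 : α < 1) (ht : StrictMonoOn t (Set.Iic n))
    (hk : 1 ≤ k) (hkn : k < n) :
    omega (1 - α) (offset (α / 2) t n - t (k - 1)) ≤ kernel α t n k := by
  have h1 := step_pos ht hk hkn.le
  have h2 := step_pos ht (k := k + 1) (by omega) (by omega)
  have h3 := le_average_sub_moment (sub_pos.1 h1) h2 ((monotoneOn_omega_sub hα0 hα1 _).mono
    (Icc_subset_Iio_offset hα1 ht hkn (t (k - 1))))
  have h4 : 0 ≤ if 2 ≤ k then coefB α t n (k - 1) / ratio t k else 0 := by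
    split_ifs with h
    · exact div_nonneg (coefB_nonneg hα0 hα1 ht (by omega) (by omega)) (ratio_pos ht h hkn.le).le
    · exact le_rfl
  rw [kernel, if_pos hkn, coefA_of_lt hα1 ht hkn, coefB_eq_moment α t n k]
  simp only [step] at h3 ⊢
  linarith

theorem kernel_le_of_lt (hα0 : 0 < α) (hα1 : α < 1) (ht : StrictMonoOn t (Set.Iic n))
    (hk : 1 ≤ k) (hkn : k < n) (hr : 2 ≤ k → 4 / 7 ≤ ratio t k) :
    kernel α t n k ≤ omega (1 - α) (offset (α / 2) t n - t k) := by
  have h1 := step_pos ht hk hkn.le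
  have h3 := coefB_nonneg hα0 hα1 ht hk hkn
  rw [kernel, if_pos hkn, coefA_of_lt hα1 ht hkn]
  split_ifs with h
  · have h2 := step_pos ht (k := k - 1) (by omega) (by omega)
    have hsub := Icc_subset_Iio_offset hα1 ht hkn (t (k - 1 - 1))
    have h4 := average_add_moment_le (sub_pos.1 h2) (sub_pos.1 h1)
      ((monotoneOn_omega_sub hα0 hα1 _).mono hsub)
      ((convexOn_omega_sub hα0 hα1 _).subset hsub (convex_Icc _ _)) (hr h)
    have e : k - 1 + 1 = k := by omega
    rw [coefB_eq_moment, e]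
    simp only [step, ratio] at h4 ⊢
    linarith
  -- For k = 1 there is no moment from an earlier interval, so the trapezoid bound and monotonicity
  -- suffice.
  · have hsub := Icc_subset_Iio_offset hα1 ht hkn (t (k - 1))
    have hmono := (monotoneOn_omega_sub hα0 hα1 _).mono hsub
    have hlt := sub_pos.1 h1
    have h4 := integral_le_trapezoid hlt hmono
      ((convexOn_omega_sub hα0 hα1 _).subset hsub (convex_Icc _ _))
    have h5 := hmono ⟨le_rfl, hlt.le⟩ ⟨hlt.le, le_rfl⟩ hlt.le
    have h6 : 1 / step t k *
        (∫ s in (t (k - 1))..(t k), omega (1 - α) (offset (α / 2) t n - s))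
        ≤ (omega (1 - α) (offset (α / 2) t n - t (k - 1))
            + omega (1 - α) (offset (α / 2) t n - t k)) / 2 := by
      rw [one_div, inv_mul_le_iff₀ h1]
      exact h4
    simp only at h5
    linarith

theorem coefA_self (hα0 : 0 < α) (hα1 : α < 1) (ht : StrictMonoOn t (Set.Iic n)) (hn : 1 ≤ n) :
    coefA α t n n =
      (1 - α / 2) ^ (1 - α) * (step t n ^ (-α) / Real.Gamma (2 - α)) := by
  have h1 := step_pos ht hn le_rfl
  have h2 : offset (α / 2) t n ≤ t n := by
    rw [offset_eq_sub]
    have : 0 < α / 2 * step t n := by positivity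
    linarith
  rw [coefA, min_eq_right h2, integral_omega_sub hα1, offset_sub_prev,
    Real.mul_rpow (by linarith) h1.le, sub_eq_add_neg 1 α, Real.rpow_add h1, Real.rpow_one]
  field_simp

theorem coefA_self_le_kernel (hα0 : 0 < α) (hα1 : α < 1) (ht : StrictMonoOn t (Set.Iic n)) :
    coefA α t n n ≤ kernel α t n n := by
  rw [kernel, if_neg (lt_irrefl n), sub_zero]
  split_ifs with h
  · exact le_add_of_nonneg_right
      (div_nonneg (coefB_nonneg hα0 hα1 ht (by omega) (by omega)) (ratio_pos ht h le_rfl).le)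
  · simp

/-- Both sides are powers of (1-ς)τ_n; the factor 1-α comes from Γ(2-α) = (1-α)Γ(1-α). -/
theorem omega_offset_sub_prev (hα1 : α < 1) (ht : StrictMonoOn t (Set.Iic n)) (hn : 1 ≤ n)
    (hα0 : 0 < α) :
    (1 - α / 2) * omega (1 - α) (offset (α / 2) t n - t (n - 1)) =
      (1 - α) * coefA α t n n := by
  have h1 := step_pos ht hn le_rfl
  have hG : Real.Gamma (2 - α) = (1 - α) * Real.Gamma (1 - α) := by
    rw [← Real.Gamma_add_one (by linarith)]
    ring_nf
  have h2 : 0 < 1 - α / 2 := by linarith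
  have h3 : 1 - α ≠ 0 := by linarith
  have h4 : Real.Gamma (1 - α) ≠ 0 := (Real.Gamma_pos_of_pos (by linarith)).ne'
  have e : 1 - α - 1 = -α := by ring
  rw [coefA_self hα0 hα1 ht hn, offset_sub_prev, omega, e, Real.mul_rpow h2.le h1.le, hG,
    sub_eq_add_neg 1 α, Real.rpow_add h2, Real.rpow_one]
  rw [sub_eq_add_neg] at h3 h4
  field_simp

/-- The last two kernels satisfy `(1 - α / 2) B₁ ≤ (1 - α) B₀`. -/
theorem kernel_pred_le (hα0 : 0 < α) (hα1 : α < 1) (ht : StrictMonoOn t (Set.Iic n))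
    (hn : 2 ≤ n) (hr : ∀ k, 2 ≤ k → k ≤ n → 4 / 7 ≤ ratio t k) :
    (1 - α / 2) * kernel α t n (n - 1) ≤ (1 - α) * kernel α t n n := by
  calc _ ≤ (1 - α / 2) * omega (1 - α) (offset (α / 2) t n - t (n - 1)) :=
        mul_le_mul_of_nonneg_left (kernel_le_of_lt hα0 hα1 ht (by omega) (by omega)
          fun h => hr _ h (by omega)) (by linarith)
    _ = (1 - α) * coefA α t n n := omega_offset_sub_prev hα1 ht (by omega) hα0
    _ ≤ _ := mul_le_mul_of_nonneg_left (coefA_self_le_kernel hα0 hα1 ht) (by linarith)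

/-- The value of the weight at t_k separates the two kernels. -/
theorem kernel_le_kernel_succ (hα0 : 0 < α) (hα1 : α < 1) (ht : StrictMonoOn t (Set.Iic n))
    (hk : 1 ≤ k) (hkn : k + 1 < n) (hr : 2 ≤ k → 4 / 7 ≤ ratio t k) :
    kernel α t n k ≤ kernel α t n (k + 1) :=
  (kernel_le_of_lt hα0 hα1 ht hk (by omega) hr).trans
    (le_kernel_of_lt hα0 hα1 ht (k := k + 1) (by omega) hkn)

theorem kernel_nonneg (hα0 : 0 < α) (hα1 : α < 1) (ht : StrictMonoOn t (Set.Iic n))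
    (hk : 1 ≤ k) (hkn : k < n) : 0 ≤ kernel α t n k := by
  refine le_trans ?_ (le_kernel_of_lt hα0 hα1 ht hk hkn)
  have h := lt_offset hα1 ht (k := k - 1) (by omega)
  exact div_nonneg (Real.rpow_nonneg (sub_nonneg.2 h.le) _)
    (Real.Gamma_pos_of_pos (by linarith)).le

theorem le_kernel_of_step_le {c : ℝ} (hα0 : 0 < α) (hα1 : α < 1)
    (ht : StrictMonoOn t (Set.Iic n)) (hn : 1 ≤ n) (hc : 0 < c)
    (h : step t n ≤ stepBound α c) : c ≤ kernel α t n n := by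
  refine le_trans ?_ (coefA_self_le_kernel hα0 hα1 ht)
  have h1 := step_pos ht hn le_rfl
  have hG : 0 < Real.Gamma (2 - α) := Real.Gamma_pos_of_pos (by linarith)
  have h2 : step t n ^ α ≤ 4 / (11 * c * Real.Gamma (2 - α)) := by
    have := Real.rpow_le_rpow h1.le h hα0.le
    rwa [stepBound, ← Real.rpow_mul (by positivity), one_div_mul_cancel hα0.ne',
      Real.rpow_one] at this
  -- The leading factor of `coefA_self` is at least 1/2, which exceeds the 4/11 in the step bound.
  have h3 : 1 / 2 ≤ (1 - α / 2) ^ (1 - α) :=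
    calc (1 : ℝ) / 2 ≤ (1 - α / 2) ^ (1 : ℝ) := by rw [Real.rpow_one]; linarith
      _ ≤ _ := Real.rpow_le_rpow_of_exponent_ge (by linarith) (by linarith) (by linarith)
  have h4 : 0 < step t n ^ α := by positivity
  rw [coefA_self hα0 hα1 ht hn, Real.rpow_neg h1.le]
  rw [le_div_iff₀ (by positivity)] at h2
  calc c ≤ 4 / 11 * ((step t n ^ α)⁻¹ / Real.Gamma (2 - α)) := by
        field_simp
        linarith
    _ ≤ _ := by gcongr; linarith

end

/-! ### The nonlinearity -/

/-- The mean value inequality towards the zero β gives the upper bound, towards the zero -β the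
lower one. -/
theorem abs_add_mul_le {D : Set ℝ} {F f : ℝ → ℝ} {β κ : ℝ} (hf : IsPotential D F f β)
    (hκ : ∀ x ∈ Set.Icc (-β) β, |deriv f x| ≤ κ) {x : ℝ} (hx : |x| ≤ β) :
    |f x + κ * x| ≤ κ * β := by
  have hβ := hf.beta_pos
  have hd : ∀ y ∈ Set.Icc (-β) β, DifferentiableAt ℝ f y := fun y hy =>
    (hf.contDiffOn.contDiffAt (hf.isOpen_dom.mem_nhds (hf.Icc_subset hy))).differentiableAt
      one_ne_zero
  have hx' : x ∈ Set.Icc (-β) β := abs_le.1 hx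
  have key : ∀ y ∈ Set.Icc (-β) β, |f x - f y| ≤ κ * |x - y| := fun y hy =>
    (convex_Icc (-β) β).norm_image_sub_le_of_norm_deriv_le hd hκ hy hx'
  have h1 := key β ⟨by linarith, le_rfl⟩
  have h2 := key (-β) ⟨le_rfl, by linarith⟩
  rw [hf.map_beta, abs_of_nonpos (by linarith [hx'.2] : x - β ≤ 0)] at h1
  rw [hf.map_neg_beta, abs_of_nonneg (by linarith [hx'.1] : 0 ≤ x - -β)] at h2
  have h3 := abs_le.1 h1
  have h4 := abs_le.1 h2
  exact abs_le.2 ⟨by linarith, by linarith⟩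

/-! ### The discrete maximum principle -/

section

variable {M : ℕ}

theorem exists_norm_eq [NeZero M] (u : Grid M) : ∃ p, ‖u‖ = |u p| := by
  obtain ⟨p, hp⟩ := Finite.exists_max fun p => |u p|
  exact ⟨p, le_antisymm ((pi_norm_le_iff_of_nonneg (abs_nonneg _)).2 hp) (norm_le_pi_norm u p)⟩

theorem abs_apply_le_norm [NeZero M] (u : Grid M) (p : ZMod M × ZMod M) : |u p| ≤ ‖u‖ := norm_le_pi_norm u p

theorem lap_add_smul (h a b : ℝ) (u v : Grid M) (p : ZMod M × ZMod M) :
    lap h (a • u + b • v) p = a * lap h u p + b * lap h v p := by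
  simp only [lap, Pi.add_apply, Pi.smul_apply, smul_eq_mul]
  ring

theorem lap_nonpos_of_max (h : ℝ) {u : Grid M} {p : ZMod M × ZMod M} (hp : ∀ q, u q ≤ u p) :
    lap h u p ≤ 0 := by
  refine div_nonpos_of_nonpos_of_nonneg ?_ (sq_nonneg h)
  linarith [hp (p.1 + 1, p.2), hp (p.1 - 1, p.2), hp (p.1, p.2 + 1), hp (p.1, p.2 - 1)]

theorem lap_neg (h : ℝ) (u : Grid M) (p : ZMod M × ZMod M) : lap h (-u) p = -lap h u p := by
  simp only [lap, Pi.neg_apply]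
  ring

/-- The explicit part of the scheme is a contraction as long as its diagonal is nonnegative. -/
theorem mul_add_lap_le {h β c d : ℝ} {v : Grid M} (hv : ∀ p, v p ≤ β) (hc : 0 ≤ c)
    (hcd : 4 * c / h ^ 2 ≤ d) (p : ZMod M × ZMod M) : d * v p + c * lap h v p ≤ d * β := by
  have h1 : c * lap h v p ≤ 4 * c / h ^ 2 * (β - v p) := by
    have : lap h v p ≤ 4 / h ^ 2 * (β - v p) := by
      rw [lap, div_mul_eq_mul_div]
      gcongr
      linarith [hv (p.1 + 1, p.2), hv (p.1 - 1, p.2), hv (p.1, p.2 + 1), hv (p.1, p.2 - 1)]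
    calc _ ≤ c * (4 / h ^ 2 * (β - v p)) := by gcongr
      _ = _ := by ring
  nlinarith [mul_le_mul_of_nonneg_right hcd (sub_nonneg.2 (hv p))]

/-- One step of the stabilized scheme, evaluated at a maximum point of the new solution. -/
theorem step_le_of_max {A c d β κ σ m e h W : ℝ} {u v E g : Grid M} (hm : 0 ≤ m) (he : 0 ≤ e)
    (hσ0 : 0 ≤ σ) (hσ1 : σ ≤ 1) (hW : 0 ≤ W)
    (hd : m * σ * (4 * e / h ^ 2 + κ) ≤ d) (hv : ∀ p, v p ≤ β)
    (hE : ∀ p, E p ≤ c) (hg : ∀ p, g p ≤ κ * β)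
    (heq : ∀ p, A * u p - d * v p - E p =
      m * (e * lap h ((1 - σ) • u + σ • v) p + W * g p - κ * ((1 - σ) * u p + σ * v p)))
    {p : ZMod M × ZMod M} (hp : ∀ q, u q ≤ u p) :
    (A + κ * (1 - σ) * m) * u p ≤ d * β + c - κ * σ * m * β + κ * m * W * β := by
  -- The weight left for `v` after paying for stabilization is d - mσκ, and `hd` says it still
  -- dominates the diagonal of the explicit Laplacian.
  have h1 := mul_add_lap_le (h := h) (c := m * σ * e) (d := d - m * σ * κ) hv (by positivity)
    (by linarith [show 4 * (m * σ * e) / h ^ 2 = m * σ * (4 * e / h ^ 2) by ring]) p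
  have h2 : m * e * (1 - σ) * lap h u p ≤ 0 :=
    mul_nonpos_of_nonneg_of_nonpos (mul_nonneg (by positivity) (by linarith))
      (lap_nonpos_of_max h hp)
  have h3 : m * W * g p ≤ m * W * (κ * β) := by
    gcongr
    exact hg p
  have h4 := heq p
  rw [lap_add_smul] at h4
  linarith [hE p]

/-- The identity `heq` is odd in (u, v, E, g) jointly, so a negative extremum reduces to a maximum
by changing all signs. -/
theorem norm_step_le [NeZero M] {A c d β κ σ m e h W : ℝ} {u v E g : Grid M} (hm : 0 ≤ m)
    (he : 0 ≤ e) (hσ0 : 0 ≤ σ) (hσ1 : σ ≤ 1) (hW : 0 ≤ W)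
    (hd : m * σ * (4 * e / h ^ 2 + κ) ≤ d) (hv : ∀ p, |v p| ≤ β)
    (hE : ∀ p, |E p| ≤ c) (hg : ∀ p, |g p| ≤ κ * β)
    (heq : ∀ p, A * u p - d * v p - E p =
      m * (e * lap h ((1 - σ) • u + σ • v) p + W * g p - κ * ((1 - σ) * u p + σ * v p))) :
    (A + κ * (1 - σ) * m) * ‖u‖ ≤ d * β + c - κ * σ * m * β + κ * m * W * β := by
  obtain ⟨p, hp⟩ := exists_norm_eq u
  have hq : ∀ q, |u q| ≤ |u p| := fun q => hp ▸ abs_apply_le_norm u q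
  rw [hp]
  rcases abs_choice (u p) with h0 | h0 <;> rw [h0] at hq ⊢
  · exact step_le_of_max hm he hσ0 hσ1 hW hd (fun p => (abs_le.1 (hv p)).2)
      (fun p => (abs_le.1 (hE p)).2) (fun p => (abs_le.1 (hg p)).2) heq
      fun q => (le_abs_self _).trans (hq q)
  · refine step_le_of_max (u := -u) (v := -v) (E := -E) (g := -g) hm he hσ0 hσ1 hW hd
      (fun p => (neg_le_abs _).trans (hv p)) (fun p => (neg_le_abs _).trans (hE p))
      (fun p => (neg_le_abs _).trans (hg p)) (fun p => ?_) fun q => (neg_le_abs _).trans (hq q)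
    rw [smul_neg, smul_neg, ← neg_add, lap_neg]
    simp only [Pi.neg_apply]
    linarith [heq p]

/-- The maximum bound for one step of the fully implicit prediction. -/
theorem abs_le_of_implicit_step [NeZero M] {D : Set ℝ} {F f : ℝ → ℝ} {β B m e h σ : ℝ}
    (hf : IsPotential D F f β) (hB : 0 ≤ B) (hm : 0 < m) (he : 0 ≤ e) (hσ1 : σ < 1)
    {u v x : Grid M} (hv : ∀ p, |v p| ≤ β) (hx : ∀ p, x p = (1 - σ) * u p + σ * v p)
    (hD : ∀ p, x p ∈ D) (heq : ∀ p, B * (u p - v p) = m * (e * lap h x p + f (x p)))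
    (p : ZMod M × ZMod M) : |x p| ≤ β := by
  have hσ : 0 < 1 - σ := by linarith
  have hxv : ∀ q, x q - v q = (1 - σ) * (u q - v q) := fun q => by rw [hx]; ring
  -- Extrema are taken of the off-set value `x`, where both the Laplacian and `f` are evaluated. If
  -- `x` exceeds β there, then u > v at that point, while the right-hand side is negative.
  obtain ⟨q, hq⟩ := Finite.exists_max x
  obtain ⟨q', hq'⟩ := Finite.exists_min x
  have hmax : x q ≤ β := by
    by_contra! hlt
    have h1 := hf.neg_right _ (hD q) hlt
    have h2 := lap_nonpos_of_max h hq
    have h3 : 0 < (1 - σ) * (u q - v q) := by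
      rw [← hxv]
      linarith [(abs_le.1 (hv q)).2]
    have h4 := mul_nonneg hB (pos_of_mul_pos_right h3 hσ.le).le
    rw [heq] at h4
    have h5 := nonneg_of_mul_nonneg_right h4 hm
    linarith [mul_nonpos_of_nonneg_of_nonpos he h2]
  have hmin : -β ≤ x q' := by
    by_contra! hlt
    have h1 := hf.pos_left _ (hD q') hlt
    have h2 := lap_nonpos_of_max h (u := -x) (p := q') fun q => neg_le_neg (hq' q)
    rw [lap_neg] at h2
    have h3 : 0 < (1 - σ) * (v q' - u q') := by
      have := hxv q'
      linarith [(abs_le.1 (hv q')).1]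
    have h4 := mul_nonneg hB (pos_of_mul_pos_right h3 hσ.le).le
    have h5 : 0 < m * (e * lap h x q' + f (x q')) :=
      mul_pos hm (by linarith [mul_nonneg he (neg_nonpos.1 h2)])
    linarith [heq q']
  exact abs_le.2 ⟨hmin.trans (hq' p), (hq p).trans hmax⟩

end

/-- Summation by parts against nonnegative increasing weights. -/
theorem abs_history_le {b x : ℕ → ℝ} {β : ℝ} {J : ℕ} (hJ : 1 ≤ J) (h1 : 0 ≤ b 1)
    (hb : ∀ k, 1 ≤ k → k < J → b k ≤ b (k + 1)) (hx : ∀ k, k ≤ J → |x k| ≤ β) :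
    |b J * x J - ∑ k ∈ Finset.Icc 1 J, b k * (x k - x (k - 1))| ≤ b J * β := by
  induction J, hJ using Nat.le_induction with
  | base =>
    have e : b 1 * x 1 - ∑ k ∈ Finset.Icc 1 1, b k * (x k - x (k - 1)) = b 1 * x 0 := by
      simp
      ring
    rw [e, abs_mul, abs_of_nonneg h1]
    exact mul_le_mul_of_nonneg_left (hx 0 (by omega)) h1
  | succ J hJ ih =>
    have ih' := ih (fun k hk hkJ => hb k hk (by omega)) fun k hk => hx k (by omega)
    have e : b (J + 1) * x (J + 1) - ∑ k ∈ Finset.Icc 1 (J + 1), b k * (x k - x (k - 1))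
        = (b (J + 1) - b J) * x J
          + (b J * x J - ∑ k ∈ Finset.Icc 1 J, b k * (x k - x (k - 1))) := by
      rw [Finset.sum_Icc_succ_top (by omega), Nat.add_sub_cancel]
      ring
    have hJb : 0 ≤ b (J + 1) - b J := sub_nonneg.2 (hb J hJ (by omega))
    have h2 : |(b (J + 1) - b J) * x J| ≤ (b (J + 1) - b J) * β := by
      rw [abs_mul, abs_of_nonneg hJb]
      exact mul_le_mul_of_nonneg_left (hx J (by omega)) hJb
    rw [e]
    refine (abs_add_le _ _).trans ?_
    linarith

/-- The discrete Caputo derivative at step `n` splits into `B₀ uⁿ`, a multiple `d` of `uⁿ⁻¹` and a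
remainder bounded by `(B₀ - d) β`. -/
theorem exists_caputo_split {α c : ℝ} {t : ℕ → ℝ} {n : ℕ} (hα0 : 0 < α) (hα1 : α < 1)
    (ht : StrictMonoOn t (Set.Iic n)) (hn : 1 ≤ n)
    (hr : ∀ k, 2 ≤ k → k ≤ n → 4 / 7 ≤ ratio t k)
    (h1 : n = 1 → α / 2 * c ≤ kernel α t n n) (hc : (1 - α / 2) * c ≤ kernel α t n n) :
    ∃ d, α / 2 * c ≤ d ∧ ∀ (M : ℕ) (β : ℝ) (u : ℕ → Grid M),
      (∀ k, k < n → ∀ p, |u k p| ≤ β) → ∀ p,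
        |kernel α t n n * u n p - d * u (n - 1) p - caputo α t u n p|
          ≤ (kernel α t n n - d) * β := by
  have hcap : ∀ (M : ℕ) (u : ℕ → Grid M) p, caputo α t u n p =
      ∑ k ∈ Finset.Icc 1 n, kernel α t n k * (u k p - u (k - 1) p) := fun M u p => by
    simp [caputo, Finset.sum_apply]
  obtain ⟨j, rfl⟩ : ∃ j, n = j + 1 := ⟨n - 1, by omega⟩
  rcases Nat.eq_zero_or_pos j with rfl | hj
  -- At the first level there is no history: d = B₀ and the remainder vanishes.
  · refine ⟨_, h1 rfl, fun M β u _ p => le_of_eq ?_⟩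
    rw [hcap]
    simp
    ring
  -- With d = B₀ - B₁ the remainder is exactly the expression of `abs_history_le` with final weight
  -- B₁. The lower bound on d uses (1-ς) - (1-α) = ς.
  · refine ⟨kernel α t (j + 1) (j + 1) - kernel α t (j + 1) j, ?_, fun M β u hu p => ?_⟩
    · have h2 := kernel_pred_le hα0 hα1 ht (by omega) hr
      simp only [Nat.add_sub_cancel] at h2
      have h3 : (1 - α / 2) * (α / 2 * c)
          ≤ (1 - α / 2) * (kernel α t (j + 1) (j + 1) - kernel α t (j + 1) j) := by
        have := mul_le_mul_of_nonneg_left hc (by linarith : 0 ≤ α / 2)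
        linarith
      exact le_of_mul_le_mul_left h3 (by linarith)
    · have h2 := abs_history_le (b := kernel α t (j + 1)) (x := fun k => u k p) hj
        (kernel_nonneg hα0 hα1 ht le_rfl (by omega))
        (fun k hk hkj => kernel_le_kernel_succ hα0 hα1 ht hk (by omega) fun h =>
          hr k h (by omega)) fun k hk => hu k (by omega) p
      rw [hcap, Finset.sum_Icc_succ_top (by omega), Nat.add_sub_cancel]
      convert h2 using 1
      · congr 1
        ring
      · ring

end TFAC

/-! ### Induction over the time levels -/

theorem mainTheorem5
    (M : ℕ) [NeZero M] (L h : ℝ) (hL : 0 < L) (hh : h = L / M)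
    (α m ε κ β : ℝ) (hα0 : 0 < α) (hα1 : α < 1) (hm : 0 < m) (hε : 0 < ε) (hκ : 0 ≤ κ)
    (D : Set ℝ) (F f V : ℝ → ℝ)
    (hf : TFAC.IsPotential D F f β)
    (hV : TFAC.IsAuxiliary V 1)
    (N : ℕ) (hN : 1 ≤ N) (t : ℕ → ℝ) (ht0 : t 0 = 0) (ht : ∀ k, k < N → t k < t (k + 1))
    -- step-ratio condition
    (hratio : ∀ k, 2 ≤ k → k ≤ N → 4 / 7 ≤ TFAC.ratio t k)
    -- `κ ≥ ‖f'‖` in the maximum norm on `[-β, β]`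
    (hκf : ∀ x ∈ Set.Icc (-β) β, |deriv f x| ≤ κ)
    -- restrictions on the first time step (the second one is void for `κ = 0`)
    (hτ1 : TFAC.step t 1 ≤ TFAC.stepBound α (α / 2 * m * (κ + 4 * ε ^ 2 / h ^ 2)))
    (hτ1' : 0 < κ → TFAC.step t 1 ≤ TFAC.stepBound α (κ * (1 - α / 2) * m))
    -- restriction on all time steps
    (hτ : ∀ n, 1 ≤ n → n ≤ N →
      TFAC.step t n ≤ TFAC.stepBound α ((1 - α / 2) * m * (4 * ε ^ 2 / h ^ 2 + κ)))
    (φ φhat : ℕ → TFAC.Grid M) (R : ℕ → ℝ)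
    (hscheme : TFAC.IsUnbalancedScheme D F f V α m ε κ β h N t φ φhat R)
    (hφ0 : ‖φ 0‖ ≤ β) :
    ∀ n, 1 ≤ n → n ≤ N →
      ‖φ n‖ ≤ β ∧
      κ * m * (TFAC.auxValue V F α h φ φhat R n - 1) * β ≤ 0 ∧
      (TFAC.kernel α t n n + κ * (1 - α / 2) * m) * ‖φ n‖ ≤
        TFAC.kernel α t n n * β + κ * (1 - α / 2) * m * β
          + κ * m * (TFAC.auxValue V F α h φ φhat R n - 1) * β := by
  have hβ := hf.beta_pos
  have hh0 : 0 < h := hh ▸ div_pos hL (Nat.cast_pos.2 (Nat.pos_of_neZero M))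
  have hmono : ∀ n, n ≤ N → StrictMonoOn t (Set.Iic n) := fun n hn =>
    strictMonoOn_of_lt_add_one Set.ordConnected_Iic fun a _ _ ha' =>
      ht a (Nat.lt_of_succ_le (le_trans (Set.mem_Iic.1 ha') hn))
  have hpos : 0 < 4 * ε ^ 2 / h ^ 2 + κ := by positivity
  have hς : 0 < 1 - α / 2 := by linarith
  intro n
  induction n using Nat.strong_induction_on with
  | _ n ih =>
  intro hn hnN
  have hst := hmono n hnN
  have hprev : ∀ k, k < n → ∀ p, |φ k p| ≤ β := fun k hk p => by
    refine (TFAC.abs_apply_le_norm _ p).trans ?_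
    rcases Nat.eq_zero_or_pos k with rfl | hk0
    · exact hφ0
    · exact (ih k hk hk0 (by omega)).1
  have hB : (1 - α / 2) * (m * (4 * ε ^ 2 / h ^ 2 + κ)) ≤ TFAC.kernel α t n n := by
    rw [← mul_assoc]
    exact TFAC.le_kernel_of_step_le hα0 hα1 hst hn (by positivity) (hτ n hn hnN)
  have hB0 : 0 < TFAC.kernel α t n n := lt_of_lt_of_le (by positivity) hB
  have hB1 : n = 1 → α / 2 * (m * (4 * ε ^ 2 / h ^ 2 + κ)) ≤ TFAC.kernel α t n n := by
    rintro rfl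
    rw [← mul_assoc, add_comm _ κ]
    exact TFAC.le_kernel_of_step_le hα0 hα1 hst hn (by positivity) hτ1
  obtain ⟨d, hd, hsplit⟩ := TFAC.exists_caputo_split hα0 hα1 hst hn
    (fun k hk hkn => hratio k hk (hkn.trans hnN)) hB1 hB
  have hpred : ∀ p, |TFAC.predOffset α φ φhat n p| ≤ β := by
    rcases Nat.lt_or_ge n 2 with hn2 | hn2
    · obtain rfl : n = 1 := by omega
      refine TFAC.abs_le_of_implicit_step hf hB0.le hm (sq_nonneg ε) (by linarith)
        (u := φhat 1) (v := φ 0) (h := h) (hprev 0 one_pos) (fun p => rfl)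
        hscheme.predict_one_mem fun p => ?_
      simpa using congrFun hscheme.predict_one p
    · intro p
      have h1 : |φhat n p| ≤ β := by
        rw [hscheme.predict n hn2 hnN p]
        exact abs_le.2 ⟨le_min (le_max_right _ _) (by linarith), min_le_right _ _⟩
      have h2 := hprev (n - 1) (by omega) p
      calc |TFAC.predOffset α φ φhat n p|
          = |(1 - α / 2) * φhat n p + α / 2 * φ (n - 1) p| := rfl
        _ ≤ |(1 - α / 2) * φhat n p| + |α / 2 * φ (n - 1) p| := abs_add_le _ _
        _ = (1 - α / 2) * |φhat n p| + α / 2 * |φ (n - 1) p| := by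
          rw [abs_mul, abs_mul, abs_of_pos hς, abs_of_pos (half_pos hα0)]
        _ ≤ (1 - α / 2) * β + α / 2 * β := by gcongr
        _ = β := by ring
  have hV0 : 0 ≤ TFAC.auxValue V F α h φ φhat R n := hV.nonneg _
  have hV1 : TFAC.auxValue V F α h φ φhat R n ≤ 1 := hV.le_bound _
  have hphase := hscheme.phase n hn hnN
  have hmain := TFAC.norm_step_le (A := TFAC.kernel α t n n) (d := d) (σ := α / 2) (h := h)
    (e := ε ^ 2) (κ := κ) (u := φ n) (v := φ (n - 1))
    (E := fun p => TFAC.kernel α t n n * φ n p - d * φ (n - 1) p - TFAC.caputo α t φ n p)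
    (g := fun p => f (TFAC.predOffset α φ φhat n p) + κ * TFAC.predOffset α φ φhat n p)
    hm.le (sq_nonneg ε) (by linarith) (by linarith) hV0 (by linarith) (hprev (n - 1) (by omega))
    (hsplit M β φ hprev) (fun p => TFAC.abs_add_mul_le hf hκf (hpred p)) fun p => by
      have h1 := congrFun hphase p
      simp only [TFAC.offset, Pi.smul_apply, Pi.add_apply, Pi.sub_apply, smul_eq_mul] at h1
      linarith
  have hP : κ * m * (TFAC.auxValue V F α h φ φhat R n - 1) * β ≤ 0 :=
    mul_nonpos_of_nonpos_of_nonneg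
      (mul_nonpos_of_nonneg_of_nonpos (by positivity) (by linarith)) hβ.le
  -- In `hmain` the history bound is (B₀ - d)β, so `d` cancels, and -κςmβ + κmVβ regroups as
  -- κ(1-ς)mβ plus the penalty.
  have hfinal : (TFAC.kernel α t n n + κ * (1 - α / 2) * m) * ‖φ n‖ ≤
      TFAC.kernel α t n n * β + κ * (1 - α / 2) * m * β
        + κ * m * (TFAC.auxValue V F α h φ φhat R n - 1) * β := by
    linarith
  refine ⟨?_, hP, hfinal⟩
  have hA : 0 < TFAC.kernel α t n n + κ * (1 - α / 2) * m := by positivity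
  exact le_of_mul_le_mul_left (by linarith) hA
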